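/- Let $K \ge 2$ and $T$ be natural numbers with $T \ge 32(K-1)\log 14$. A randomised bandit algorithm chooses, in each round $t \in \{1,\dots,T\}$, a probability distribution $p_t$ on $\{1,\dots,K\}$ as a (measurable) function of the history $(I_s,\ell_{I_s,s})_{1\le s\le t-1}$, samples an arm $I_t$ from $p_t$, and observes only the loss $\ell_{I_t,t}$ of that arm. For a loss sequence $\ell_{1:T} = (\ell_{i,t})_{1\le i\le K,\,1\le t\le T} \in [0,1]^{KT}$ the regret is \[ R_T(\ell_{1:T}) = \sum_{t=1}^T \ell_{I_t,t} - \min_{1\le i\le K} \sum_{t=1}^T \ell_{i,t}. \] Then, for any randomised bandit algorithm, there is a loss sequence $\ell_{1:T} \in [0,1]^{KT}$ such that there exists an arm $i^*$ that is optimal at every round (i.e., $\ell_{i^*,t} = \min_{1\le i\le K} \ell_{i,t}$ for all $1\le t\le T$), but \[ \mathbb{E}[R_T(\ell_{1:T})] \ge \frac{\sqrt{T(K-1)}}{504}, \] where the expectation is with respect to the randomness in the algorithm (the loss sequence is fixed). -/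

import Mathlib

/-- A randomised bandit algorithm with `K` arms and losses in `[0,1]`. At the beginning of a round
which is preceded by `t` rounds, the learner has seen the history of those `t` rounds (the arm
pulled and the loss of that arm, in each of them) and picks a probability distribution on the arms,
which is a measurable function of the history. -/
structure BanditAlgorithm (K : ℕ) where
  /-- the distribution from which the next arm is sampled, given the history -/
  policy : (t : ℕ) → (Fin t → Fin K × unitInterval) → PMF (Fin K)
  /-- each weight depends measurably on the history -/
  measurable_policy : ∀ (t : ℕ) (i : Fin K), Measurable fun h => policy t h i

namespace BanditAlgorithm

variable {K : ℕ}

/-- The law of the arms `I` pulled in `T` rounds against the fixed loss sequence `ℓ`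
(`ℓ t i` is the loss of arm `i` in round `t`): the arm of the last round is sampled from the
distribution that the algorithm computes from the arms and the observed losses of the
previous rounds. -/
noncomputable def actionLaw (A : BanditAlgorithm K) :
    (T : ℕ) → (Fin T → Fin K → unitInterval) → PMF (Fin T → Fin K)
  | 0, _ => PMF.pure Fin.elim0
  | T + 1, ℓ =>
    (actionLaw A T fun s => ℓ s.castSucc).bind fun I =>
      (A.policy T fun s => (I s, ℓ s.castSucc (I s))).map fun i =>
        (Fin.snoc I i : Fin (T + 1) → Fin K)

end BanditAlgorithm

/-- The regret of the sequence of arms `I` against the loss sequence `ℓ`. -/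
noncomputable def banditRegret {K T : ℕ} (ℓ : Fin T → Fin K → unitInterval)
    (I : Fin T → Fin K) : ℝ :=
  ∑ t, (ℓ t (I t) : ℝ) - ⨅ i : Fin K, ∑ t, (ℓ t i : ℝ)

/-- The expected regret against the loss sequence `ℓ`, where the expectation is with respect to
the randomness of the algorithm. -/
noncomputable def BanditAlgorithm.expectedRegret {K T : ℕ} (A : BanditAlgorithm K)
    (ℓ : Fin T → Fin K → unitInterval) : ℝ :=
  ∫ I, banditRegret ℓ I ∂(A.actionLaw T ℓ).toMeasure

/-- Expectation of `F` over the trajectory of length `T` of an adaptive process on `S` whose next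
state has weights `k t h` given the past `h` of length `t`. -/
noncomputable def adaptiveExp {S : Type*} [Fintype S] (k : (t : ℕ) → (Fin t → S) → S → ℝ) :
    (T : ℕ) → ((Fin T → S) → ℝ) → ℝ
  | 0, F => F Fin.elim0
  | T + 1, F => adaptiveExp k T fun h => ∑ s, k T h s * F (Fin.snoc h s : Fin (T + 1) → S)

/-- The weights of an adaptive process are probability distributions. -/
structure IsAdaptiveProb {S : Type*} [Fintype S] (k : (t : ℕ) → (Fin t → S) → S → ℝ) : Prop where
  nonneg : ∀ t h s, 0 ≤ k t h s
  sum_eq_one : ∀ t h, ∑ s, k t h s = 1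

section AdaptiveExp

variable {S S' : Type*} [Fintype S] [Fintype S'] {k : (t : ℕ) → (Fin t → S) → S → ℝ}

theorem adaptiveExp_mono (hk : IsAdaptiveProb k) :
    ∀ (T : ℕ) {F G : (Fin T → S) → ℝ}, (∀ h, F h ≤ G h) → adaptiveExp k T F ≤ adaptiveExp k T G
  | 0, _, _, hFG => hFG _
  | T + 1, _, _, hFG => adaptiveExp_mono hk T fun h =>
      Finset.sum_le_sum fun s _ => mul_le_mul_of_nonneg_left (hFG _) (hk.nonneg T h s)

theorem adaptiveExp_add :
    ∀ (T : ℕ) (F G : (Fin T → S) → ℝ),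
      adaptiveExp k T (fun h => F h + G h) = adaptiveExp k T F + adaptiveExp k T G
  | 0, _, _ => rfl
  | T + 1, F, G => by
      simp only [adaptiveExp, mul_add, Finset.sum_add_distrib]
      exact adaptiveExp_add T _ _

theorem adaptiveExp_const_mul (c : ℝ) :
    ∀ (T : ℕ) (F : (Fin T → S) → ℝ),
      adaptiveExp k T (fun h => c * F h) = c * adaptiveExp k T F
  | 0, _ => rfl
  | T + 1, F => by
      simp only [adaptiveExp, mul_left_comm _ c, ← Finset.mul_sum]
      exact adaptiveExp_const_mul c T _

theorem adaptiveExp_const (hk : IsAdaptiveProb k) (c : ℝ) :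
    ∀ T : ℕ, adaptiveExp k T (fun _ => c) = c
  | 0 => rfl
  | T + 1 => by
      simp only [adaptiveExp, ← Finset.sum_mul, hk.sum_eq_one, one_mul]
      exact adaptiveExp_const hk c T

theorem adaptiveExp_finset_sum {ι : Type*} (A : Finset ι) (T : ℕ) (F : ι → (Fin T → S) → ℝ) :
    adaptiveExp k T (fun h => ∑ i ∈ A, F i h) = ∑ i ∈ A, adaptiveExp k T (F i) := by
  classical
  induction A using Finset.induction_on with
  | empty => simpa using adaptiveExp_const_mul (k := k) 0 T (fun _ => 0)
  | insert a A ha ih => simp only [Finset.sum_insert ha, adaptiveExp_add, ih]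

/-- Expectations of additive functionals depend only on the conditional means of the summands. -/
theorem adaptiveExp_sum_congr (hk : IsAdaptiveProb k) {g g' : S → ℝ}
    (hg : ∀ t h, ∑ s, k t h s * g s = ∑ s, k t h s * g' s) :
    ∀ T : ℕ, adaptiveExp k T (fun h => ∑ t, g (h t)) = adaptiveExp k T (fun h => ∑ t, g' (h t))
  | 0 => by simp [adaptiveExp]
  | T + 1 => by
      simp only [adaptiveExp, Fin.sum_univ_castSucc, Fin.snoc_castSucc, Fin.snoc_last, mul_add,
        Finset.sum_add_distrib, ← Finset.sum_mul, hk.sum_eq_one, one_mul, adaptiveExp_add, hg,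
        adaptiveExp_sum_congr hk hg T]

/-- The image of an adaptive process under a map of the states. -/
theorem adaptiveExp_map {k' : (t : ℕ) → (Fin t → S') → S' → ℝ} (φ : S → S')
    (hφ : ∀ t h (G : S' → ℝ), ∑ s, k t h s * G (φ s) = ∑ s', k' t (φ ∘ h) s' * G s') :
    ∀ (T : ℕ) (F : (Fin T → S') → ℝ),
      adaptiveExp k T (fun h => F (φ ∘ h)) = adaptiveExp k' T F
  | 0, F => congrArg F (Subsingleton.elim _ _)
  | T + 1, F => by
      simp only [adaptiveExp, Fin.comp_snoc]
      rw [← adaptiveExp_map φ hφ T]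
      congr 1
      funext h
      exact hφ T h fun s' => F (Fin.snoc (φ ∘ h) s' : Fin (T + 1) → S')

/-- Change of measure: the likelihood ratio of a trajectory is the product of those of its steps. -/
theorem adaptiveExp_mul_ratio (r : S → ℝ) :
    ∀ (T : ℕ) (F : (Fin T → S) → ℝ),
      adaptiveExp (fun t h s => k t h s * r s) T F =
        adaptiveExp k T (fun h => (∏ t, r (h t)) * F h)
  | 0, F => by simp [adaptiveExp]
  | T + 1, F => by
      simp only [adaptiveExp, Fin.prod_univ_castSucc, Fin.snoc_castSucc, Fin.snoc_last]
      rw [adaptiveExp_mul_ratio r T]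
      congr 1
      funext h
      rw [Finset.mul_sum]
      exact Finset.sum_congr rfl fun s _ => by ring

end AdaptiveExp

/-- A linearised Pinsker inequality, pointwise in the likelihood ratio `L`. -/
theorem mul_le_add_log_ratio {L f a : ℝ} (hL : 0 < L) (hf0 : 0 ≤ f) (hf1 : f ≤ 1) (ha : 0 < a) :
    L * f ≤ f + (L - 1) + a + (-Real.log L - 1 + L) / a := by
  obtain ⟨s, hs, rfl⟩ : ∃ s : ℝ, 0 < s ∧ L = s ^ 2 :=
    ⟨√L, Real.sqrt_pos.2 hL, (Real.sq_sqrt hL.le).symm⟩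
  have hlog : Real.log (s ^ 2) ≤ 2 * (s - 1) := by
    rw [Real.log_pow]
    push_cast
    linarith [Real.log_le_sub_one_of_pos hs]
  have hdiv : (1 - s) ^ 2 / a ≤ (-Real.log (s ^ 2) - 1 + s ^ 2) / a := by
    gcongr
    linarith
  have hamgm : 2 * (1 - s) ≤ a + (1 - s) ^ 2 / a := by
    have h : a + (1 - s) ^ 2 / a - 2 * (1 - s) = (a - (1 - s)) ^ 2 / a := by
      field_simp
      ring
    have : 0 ≤ (a - (1 - s)) ^ 2 / a := by positivity
    linarith
  have hmain : (1 - s ^ 2) * (1 - f) ≤ a + (1 - s) ^ 2 / a := by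
    rcases le_total s 1 with h1 | h1
    · have : (1 - s ^ 2) * (1 - f) ≤ 1 - s ^ 2 :=
        mul_le_of_le_one_right (by nlinarith) (by linarith)
      nlinarith [sq_nonneg (1 - s)]
    · have h2 : (1 - s ^ 2) * (1 - f) ≤ 0 :=
        mul_nonpos_of_nonpos_of_nonneg (by nlinarith) (by linarith)
      have : 0 ≤ a + (1 - s) ^ 2 / a := by positivity
      linarith
  linarith

/-- Comparison of expectations under two adaptive processes, where `κ * c` is the conditional mean
of the log-likelihood ratio of a step. -/
theorem adaptiveExp_mul_ratio_le {S : Type*} [Fintype S] {k : (t : ℕ) → (Fin t → S) → S → ℝ}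
    {r c : S → ℝ} {κ a : ℝ} (hk : IsAdaptiveProb k)
    (hk' : IsAdaptiveProb fun t h s => k t h s * r s) (hr : ∀ s, 0 < r s) (ha : 0 < a)
    (hlog : ∀ t h, ∑ s, k t h s * -Real.log (r s) = ∑ s, k t h s * (κ * c s))
    (T : ℕ) {f : (Fin T → S) → ℝ} (hf0 : ∀ h, 0 ≤ f h) (hf1 : ∀ h, f h ≤ 1) :
    adaptiveExp (fun t h s => k t h s * r s) T f ≤
      adaptiveExp k T f + a + κ * adaptiveExp k T (fun h => ∑ t, c (h t)) / a := by
  have hKL : adaptiveExp k T (fun h => -Real.log (∏ t, r (h t))) =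
      κ * adaptiveExp k T (fun h => ∑ t, c (h t)) := by
    rw [← adaptiveExp_const_mul]
    simp only [Real.log_prod fun _ _ => (hr _).ne', ← Finset.sum_neg_distrib, Finset.mul_sum]
    exact adaptiveExp_sum_congr hk hlog T
  have hone : adaptiveExp k T (fun h => ∏ t, r (h t)) = 1 := by
    have := adaptiveExp_mul_ratio (k := k) r T (fun _ => 1)
    rw [adaptiveExp_const hk'] at this
    simpa using this.symm
  rw [adaptiveExp_mul_ratio]
  calc _ ≤ adaptiveExp k T (fun h => (f h + (a - 1 - a⁻¹)) + ((1 + a⁻¹) * ∏ t, r (h t) +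
        a⁻¹ * -Real.log (∏ t, r (h t)))) := by
        refine adaptiveExp_mono hk T fun h => ?_
        refine (mul_le_add_log_ratio (Finset.prod_pos fun t _ => hr (h t)) (hf0 h) (hf1 h)
          ha).trans_eq ?_
        ring
    _ = _ := by
        rw [adaptiveExp_add, adaptiveExp_add, adaptiveExp_add, adaptiveExp_const hk,
          adaptiveExp_const_mul, adaptiveExp_const_mul, hone, hKL]
        ring

namespace BanditAlgorithm

variable {K : ℕ}

/-- The probability with which the algorithm pulls an arm, as a real number. -/
noncomputable def armProb (A : BanditAlgorithm K) (t : ℕ) (h : Fin t → Fin K × unitInterval)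
    (j : Fin K) : ℝ :=
  (A.policy t h j).toReal

theorem armProb_nonneg (A : BanditAlgorithm K) (t : ℕ) (h : Fin t → Fin K × unitInterval)
    (j : Fin K) : 0 ≤ A.armProb t h j :=
  ENNReal.toReal_nonneg

theorem sum_armProb (A : BanditAlgorithm K) (t : ℕ) (h : Fin t → Fin K × unitInterval) :
    ∑ j, A.armProb t h j = 1 := by
  simp only [armProb]
  rw [← ENNReal.toReal_sum fun j _ => PMF.apply_ne_top _ j,
    ← tsum_fintype (L := .unconditional _), PMF.tsum_coe, ENNReal.toReal_one]

theorem actionLaw_snoc (A : BanditAlgorithm K) (T : ℕ) (ℓ : Fin (T + 1) → Fin K → unitInterval)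
    (I : Fin T → Fin K) (i : Fin K) :
    A.actionLaw (T + 1) ℓ (Fin.snoc I i : Fin (T + 1) → Fin K) =
      A.actionLaw T (fun s => ℓ s.castSucc) I *
        A.policy T (fun s => (I s, ℓ s.castSucc (I s))) i := by
  classical
  rw [actionLaw, PMF.bind_apply, tsum_eq_single I]
  · rw [PMF.map_apply, tsum_eq_single i]
    · simp
    · intro j hj
      simp [Fin.snoc_inj, hj.symm]
  · intro J hJ
    rw [PMF.map_apply]
    simp [Fin.snoc_inj, hJ.symm]

theorem integral_actionLaw_succ (A : BanditAlgorithm K) (T : ℕ)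
    (ℓ : Fin (T + 1) → Fin K → unitInterval) (F : (Fin (T + 1) → Fin K) → ℝ) :
    ∫ J, F J ∂(A.actionLaw (T + 1) ℓ).toMeasure =
      ∫ I, ∑ i, A.armProb T (fun s => (I s, ℓ s.castSucc (I s))) i *
        F (Fin.snoc I i : Fin (T + 1) → Fin K)
          ∂(A.actionLaw T fun s => ℓ s.castSucc).toMeasure := by
  rw [PMF.integral_eq_sum, PMF.integral_eq_sum,
    ← (Fin.snocEquiv fun _ : Fin (T + 1) => Fin K).sum_comp, Fintype.sum_prod_type,
    Finset.sum_comm]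
  refine Finset.sum_congr rfl fun I _ => ?_
  rw [smul_eq_mul, Finset.mul_sum]
  refine Finset.sum_congr rfl fun i _ => ?_
  simp only [Fin.snocEquiv, Equiv.coe_fn_mk, actionLaw_snoc, ENNReal.toReal_mul, smul_eq_mul,
    armProb, mul_assoc]

/-- The weights of the process of arms and feedback, where the feedback `y` on arm `j` has weight
`q j y` and reveals to the learner the loss `loss j y`. -/
noncomputable def interaction {Y : Type*} (A : BanditAlgorithm K)
    (loss : Fin K → Y → unitInterval) (q : Fin K → Y → ℝ) (t : ℕ) (h : Fin t → Fin K × Y)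
    (s : Fin K × Y) : ℝ :=
  A.armProb t (fun u => ((h u).1, loss (h u).1 (h u).2)) s.1 * q s.1 s.2

theorem isAdaptiveProb_interaction {Y : Type*} [Fintype Y] (A : BanditAlgorithm K)
    (loss : Fin K → Y → unitInterval) {q : Fin K → Y → ℝ} (hq : ∀ j y, 0 ≤ q j y)
    (hq1 : ∀ j, ∑ y, q j y = 1) : IsAdaptiveProb (A.interaction loss q) where
  nonneg t h s := mul_nonneg (A.armProb_nonneg _ _ _) (hq _ _)
  sum_eq_one t h := by
    simp only [interaction, Fintype.sum_prod_type, ← Finset.mul_sum, hq1, mul_one, sum_armProb]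

/-- Fubini's theorem for losses that are an image of independent variables with weights `w`. -/
theorem adaptiveExp_interaction_eq {Y : Type*} [Fintype Y] (A : BanditAlgorithm K)
    (loss : Fin K → Y → unitInterval) (w : Y → ℝ) :
    ∀ (T : ℕ) (F : (Fin T → Fin K) → (Fin T → Y) → ℝ),
      adaptiveExp (A.interaction loss fun _ => w) T
          (fun x => F (Prod.fst ∘ x) (Prod.snd ∘ x)) =
        adaptiveExp (fun _ _ => w) T fun ω =>
          ∫ I, F I ω ∂(A.actionLaw T fun t j => loss j (ω t)).toMeasure
  | 0, F => by
      simp only [adaptiveExp, actionLaw, PMF.integral_eq_sum, Fintype.sum_unique,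
        Subsingleton.elim (default : Fin 0 → Fin K) Fin.elim0, PMF.pure_apply]
      simp only [if_true, ENNReal.toReal_one, one_smul]
      congr 1 <;> exact Subsingleton.elim _ _
  | T + 1, F => by
      have key := adaptiveExp_interaction_eq A loss w T fun I ω =>
        ∑ y, w y * ∑ i, A.armProb T (fun s => (I s, loss (I s) (ω s))) i *
          F (Fin.snoc I i : Fin (T + 1) → Fin K) (Fin.snoc ω y : Fin (T + 1) → Y)
      simp only [adaptiveExp, Fin.comp_snoc, integral_actionLaw_succ, Fin.snoc_castSucc]
      refine Eq.trans ?_ (key.trans ?_)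
      · congr 1
        funext h
        rw [Fintype.sum_prod_type_right]
        refine Finset.sum_congr rfl fun y _ => ?_
        rw [Finset.mul_sum]
        refine Finset.sum_congr rfl fun i _ => ?_
        simp only [interaction, Function.comp_apply]
        ring
      · congr 1
        funext ω
        rw [MeasureTheory.integral_finsetSum _ fun _ _ => .of_finite]
        exact Finset.sum_congr rfl fun y _ => MeasureTheory.integral_const_mul _ _

end BanditAlgorithm

/-- The loss in `{0, 1}` coded by a Boolean. -/
def boolLoss (b : Bool) : unitInterval := if b then 1 else 0

/-- The losses in a round with outcome `y`: outcomes `0` and `2` give all arms loss `1` and `0`,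
respectively, and outcome `1` favours arm `i`. -/
def coupledLoss {K : ℕ} (i j : Fin K) (y : Fin 3) : Bool :=
  decide (y = 0 ∨ y = 1 ∧ j ≠ i)

/-- The weights of the three outcomes of a round. -/
noncomputable def coupledWeight (Δ : ℝ) : Fin 3 → ℝ := ![1 / 2 - Δ, Δ, 1 / 2]

/-- Twice the probability of the loss `b` of arm `j`, if arm `i` is favoured. -/
noncomputable def lossRatio {K : ℕ} (Δ : ℝ) (i : Fin K) (s : Fin K × Bool) : ℝ :=
  if s.1 = i then (if s.2 then 1 - 2 * Δ else 1 + 2 * Δ) else 1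

theorem boolLoss_coupledLoss_le {K : ℕ} (i j : Fin K) (y : Fin 3) :
    boolLoss (coupledLoss i i y) ≤ boolLoss (coupledLoss i j y) := by
  fin_cases y <;> by_cases h : j = i <;> simp [boolLoss, coupledLoss, h]

namespace BanditAlgorithm

variable {K : ℕ}

/-- The number of pulls of arm `i`. -/
noncomputable def pulls {Y : Type*} {T : ℕ} (i : Fin K) (h : Fin T → Fin K × Y) : ℝ :=
  ∑ t, if (h t).1 = i then 1 else 0

theorem sum_pulls {Y : Type*} {T : ℕ} (h : Fin T → Fin K × Y) : ∑ i, pulls i h = T := by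
  simp only [pulls]
  rw [Finset.sum_comm]
  simp

theorem pulls_nonneg {Y : Type*} {T : ℕ} (i : Fin K) (h : Fin T → Fin K × Y) : 0 ≤ pulls i h :=
  Finset.sum_nonneg fun t _ => by split_ifs <;> norm_num

theorem pulls_le {Y : Type*} {T : ℕ} (i : Fin K) (h : Fin T → Fin K × Y) : pulls i h ≤ T :=
  (Finset.sum_le_card_nsmul _ _ 1 fun t _ => by split_ifs <;> norm_num).trans_eq (by simp)

/-- Expectation when all the losses are fair coin flips. -/
noncomputable def fairExp (A : BanditAlgorithm K) (T : ℕ) (F : (Fin T → Fin K × Bool) → ℝ) : ℝ :=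
  adaptiveExp (A.interaction (fun _ => boolLoss) fun _ _ => 1 / 2) T F

theorem isAdaptiveProb_fair (A : BanditAlgorithm K) :
    IsAdaptiveProb (A.interaction (fun _ => boolLoss) fun _ _ => 1 / 2) :=
  A.isAdaptiveProb_interaction _ (fun _ _ => by norm_num) fun _ => by norm_num

theorem isAdaptiveProb_mul_lossRatio (A : BanditAlgorithm K) {Δ : ℝ} (hΔ0 : 0 ≤ Δ)
    (hΔ : Δ ≤ 1 / 4) (i : Fin K) :
    IsAdaptiveProb fun t h s =>
      A.interaction (fun _ => boolLoss) (fun _ _ => 1 / 2) t h s * lossRatio Δ i s := by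
  have := A.isAdaptiveProb_interaction (fun _ => boolLoss)
    (q := fun j b => 1 / 2 * lossRatio Δ i (j, b))
    (fun j b => by simp only [lossRatio]; split_ifs <;> linarith)
    (fun j => by simp only [lossRatio, Fintype.sum_bool]; split_ifs <;> simp_all <;> ring)
  convert this using 1
  funext t h s
  simp only [interaction, mul_assoc]

theorem exists_fairExp_pulls_le (A : BanditAlgorithm K) (hK : 0 < K) (T : ℕ) :
    ∃ i, A.fairExp T (pulls i) ≤ T / K := by
  have : Nonempty (Fin K) := ⟨⟨0, hK⟩⟩
  have hK' : (K : ℝ) ≠ 0 := by positivity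
  obtain ⟨i, -, hi⟩ := Finset.exists_le_of_sum_le (s := Finset.univ)
    (f := fun i : Fin K => A.fairExp T (pulls i)) (g := fun _ => (T : ℝ) / K)
    Finset.univ_nonempty (by
      simp only [fairExp]
      rw [← adaptiveExp_finset_sum]
      simp only [sum_pulls, adaptiveExp_const A.isAdaptiveProb_fair]
      simp [mul_div_cancel₀ _ hK'])
  exact ⟨i, hi⟩

theorem coupled_pulls_le (A : BanditAlgorithm K) {Δ : ℝ} (hΔ0 : 0 ≤ Δ) (hΔ : Δ ≤ 1 / 4)
    {a : ℝ} (ha : 0 < a) (i : Fin K) {T : ℕ} (hT : 0 < T) :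
    adaptiveExp (A.interaction (fun j y => boolLoss (coupledLoss i j y))
        fun _ => coupledWeight Δ) T (pulls i) ≤
      A.fairExp T (pulls i) + T * a + T * (8 / 3 * Δ ^ 2 * A.fairExp T (pulls i) / a) := by
  have hT' : (0 : ℝ) < T := by exact_mod_cast hT
  have hmap := adaptiveExp_map
    (k := A.interaction (fun j y => boolLoss (coupledLoss i j y)) fun _ => coupledWeight Δ)
    (k' := fun t h s =>
      A.interaction (fun _ => boolLoss) (fun _ _ => 1 / 2) t h s * lossRatio Δ i s)
    (fun s : Fin K × Fin 3 => (s.1, coupledLoss i s.1 s.2)) (by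
      intro t h G
      simp only [Fintype.sum_prod_type, interaction, Fin.sum_univ_three, Fintype.sum_bool,
        Function.comp_apply]
      refine Finset.sum_congr rfl fun j _ => ?_
      by_cases hj : j = i <;> simp [coupledLoss, coupledWeight, lossRatio, hj] <;> ring) T
    (pulls i)
  have hcmp := adaptiveExp_mul_ratio_le (r := lossRatio Δ i) (a := a)
    (c := fun s => if s.1 = i then 1 else 0)
    (κ := -(Real.log (1 - 2 * Δ) + Real.log (1 + 2 * Δ)) / 2)
    A.isAdaptiveProb_fair (A.isAdaptiveProb_mul_lossRatio hΔ0 hΔ i)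
    (fun s => by simp only [lossRatio]; split_ifs <;> linarith) ha (by
      intro t h
      simp only [Fintype.sum_prod_type, interaction, Fintype.sum_bool]
      refine Finset.sum_congr rfl fun j _ => ?_
      by_cases hj : j = i <;> simp [lossRatio, hj]; ring) T
    (f := fun h => (T : ℝ)⁻¹ * pulls i h)
    (fun h => mul_nonneg (by positivity) (pulls_nonneg i h))
    (fun h => by
      rw [inv_mul_le_iff₀ hT', mul_one]
      exact pulls_le i h)
  rw [adaptiveExp_const_mul, adaptiveExp_const_mul, ← hmap] at hcmp
  have hκ : -(Real.log (1 - 2 * Δ) + Real.log (1 + 2 * Δ)) / 2 ≤ 8 / 3 * Δ ^ 2 := by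
    have hpos : 3 / 4 ≤ 1 - 4 * Δ ^ 2 := by nlinarith
    rw [← Real.log_mul (by linarith) (by linarith),
      show (1 - 2 * Δ) * (1 + 2 * Δ) = 1 - 4 * Δ ^ 2 by ring]
    have hlog := Real.one_sub_inv_le_log_of_pos (x := 1 - 4 * Δ ^ 2) (by linarith)
    have hinv : (1 - 4 * Δ ^ 2)⁻¹ ≤ 1 + 16 / 3 * Δ ^ 2 := by
      rw [inv_le_iff_one_le_mul₀ (by linarith)]
      nlinarith [mul_nonneg (sq_nonneg Δ) (by linarith : 0 ≤ 1 / 4 - 4 * Δ ^ 2)]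
    linarith
  have hfair : 0 ≤ A.fairExp T (pulls i) := by
    have := adaptiveExp_mono A.isAdaptiveProb_fair T (pulls_nonneg (Y := Bool) i)
    rwa [adaptiveExp_const A.isAdaptiveProb_fair] at this
  have hstep : (T : ℝ)⁻¹ * adaptiveExp (A.interaction
      (fun j y => boolLoss (coupledLoss i j y)) fun _ => coupledWeight Δ) T (pulls i) ≤
      (T : ℝ)⁻¹ * A.fairExp T (pulls i) + a + 8 / 3 * Δ ^ 2 * A.fairExp T (pulls i) / a := by
    refine hcmp.trans ?_
    have : -(Real.log (1 - 2 * Δ) + Real.log (1 + 2 * Δ)) / 2 * A.fairExp T (pulls i) / a ≤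
        8 / 3 * Δ ^ 2 * A.fairExp T (pulls i) / a := by gcongr
    exact add_le_add_right this _
  rw [inv_mul_le_iff₀ hT'] at hstep
  refine hstep.trans_eq ?_
  field_simp

/-- The mean over the outcomes of the expected regret is at least `Δ` times the mean number of
pulls of the other arms. -/
theorem le_adaptiveExp_expectedRegret (A : BanditAlgorithm K) {Δ : ℝ} (hΔ0 : 0 ≤ Δ)
    (hΔ : Δ ≤ 1 / 4) (i : Fin K) (T : ℕ) :
    Δ * (T - adaptiveExp (A.interaction (fun j y => boolLoss (coupledLoss i j y))
        fun _ => coupledWeight Δ) T (pulls i)) ≤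
      adaptiveExp (fun _ _ => coupledWeight Δ) T fun ω =>
        A.expectedRegret fun t j => boolLoss (coupledLoss i j (ω t)) := by
  have hw0 : ∀ y, 0 ≤ coupledWeight Δ y := by
    intro y
    fin_cases y <;> simp [coupledWeight] <;> linarith
  have hw1 : ∑ y, coupledWeight Δ y = 1 := by
    simp [coupledWeight, Fin.sum_univ_three]
    ring
  have hk := A.isAdaptiveProb_interaction (fun j y => boolLoss (coupledLoss i j y))
    (q := fun _ => coupledWeight Δ) (fun _ => hw0) (fun _ => hw1)
  simp only [expectedRegret]
  rw [← A.adaptiveExp_interaction_eq (fun j y => boolLoss (coupledLoss i j y)) (coupledWeight Δ) T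
    fun I ω => banditRegret (fun t j => boolLoss (coupledLoss i j (ω t))) I]
  have hpulls : ∀ h : Fin T → Fin K × Fin 3,
      ∑ t, Δ * (1 - if (h t).1 = i then 1 else 0) = Δ * T + -Δ * pulls i h := by
    intro h
    rw [← Finset.mul_sum, Finset.sum_sub_distrib]
    simp [pulls]
    ring
  calc _ = adaptiveExp (A.interaction (fun j y => boolLoss (coupledLoss i j y))
        fun _ => coupledWeight Δ) T
          (fun h => ∑ t, Δ * (1 - if (h t).1 = i then 1 else 0)) := by
        simp only [hpulls]
        rw [adaptiveExp_add, adaptiveExp_const hk, adaptiveExp_const_mul]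
        ring
    _ = adaptiveExp (A.interaction (fun j y => boolLoss (coupledLoss i j y))
        fun _ => coupledWeight Δ) T (fun h => ∑ t,
          ((boolLoss (coupledLoss i (h t).1 (h t).2) : ℝ) -
            boolLoss (coupledLoss i i (h t).2))) := by
        refine adaptiveExp_sum_congr hk (g := fun s => Δ * (1 - if s.1 = i then 1 else 0))
          (g' := fun s => (boolLoss (coupledLoss i s.1 s.2) : ℝ) -
            boolLoss (coupledLoss i i s.2)) (fun t h => ?_) T
        simp only [Fintype.sum_prod_type, interaction]
        refine Finset.sum_congr rfl fun j _ => ?_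
        simp only [mul_assoc, ← Finset.mul_sum]
        congr 1
        by_cases hj : j = i
        · simp [hj]
        · simp only [hj, if_false, sub_zero, mul_one, ← Finset.sum_mul, hw1, one_mul]
          simp [Fin.sum_univ_three, coupledLoss, boolLoss, coupledWeight, hj]
    _ ≤ _ := by
        refine adaptiveExp_mono hk T fun h => ?_
        rw [banditRegret, Finset.sum_sub_distrib]
        exact sub_le_sub_left (ciInf_le (f := fun j =>
          ∑ t, (boolLoss (coupledLoss i j (h t).2) : ℝ)) (Set.finite_range _).bddBelow i) _

end BanditAlgorithm

theorem corollary5 (K T : ℕ) (hK : 2 ≤ K)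
    (hT : 32 * ((K : ℝ) - 1) * Real.log 14 ≤ (T : ℝ)) (A : BanditAlgorithm K) :
    ∃ ℓ : Fin T → Fin K → unitInterval,
      (∃ i : Fin K, ∀ (t : Fin T) (j : Fin K), ℓ t i ≤ ℓ t j) ∧
      √((T : ℝ) * ((K : ℝ) - 1)) / 504 ≤ A.expectedRegret ℓ := by
  have hK' : (2 : ℝ) ≤ K := by exact_mod_cast hK
  have hTK : (K : ℝ) - 1 ≤ T := by
    have := Real.one_sub_inv_le_log_of_pos (x := 14) (by norm_num)
    nlinarith
  have hTpos : (0 : ℝ) < T := by linarith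
  set R := √((T : ℝ) * ((K : ℝ) - 1)) with hR
  have hRpos : 0 < R := Real.sqrt_pos.2 (mul_pos hTpos (by linarith))
  have hR2 : R ^ 2 = T * (K - 1) := Real.sq_sqrt (mul_nonneg hTpos.le (by linarith))
  have hRT : R ≤ T := by nlinarith
  set Δ := R / (16 * T) with hΔdef
  have hΔ0 : 0 ≤ Δ := by positivity
  have hΔ : Δ ≤ 1 / 4 := by
    rw [hΔdef, div_le_iff₀ (by positivity)]
    linarith
  have hΔT : Δ * T = R / 16 := by
    rw [hΔdef]
    field_simp
  obtain ⟨i, hi⟩ := A.exists_fairExp_pulls_le (by lia) T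
  have hpulls := A.coupled_pulls_le hΔ0 hΔ (a := 1 / 4) (by norm_num) i
    (T := T) (by exact_mod_cast hTpos)
  have hregret := A.le_adaptiveExp_expectedRegret hΔ0 hΔ i T
  have hΔN : Δ ^ 2 * A.fairExp T (BanditAlgorithm.pulls i) ≤ 1 / 256 := by
    calc _ ≤ Δ ^ 2 * (T / K) := by gcongr
      _ = (K - 1) / K / 256 := by
        rw [hΔdef, div_pow, hR2]
        field_simp
        norm_num
      _ ≤ 1 / 256 := by
        gcongr
        rw [div_le_one (by linarith)]
        linarith
  have hi2 : A.fairExp T (BanditAlgorithm.pulls i) ≤ T / 2 :=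
    hi.trans (by gcongr)
  have hmean : R / 504 < adaptiveExp (fun _ _ => coupledWeight Δ) T fun ω =>
      A.expectedRegret fun t j => boolLoss (coupledLoss i j (ω t)) := by
    refine lt_of_lt_of_le ?_ hregret
    have : 5 / 24 * (T : ℝ) ≤ T - adaptiveExp (A.interaction
        (fun j y => boolLoss (coupledLoss i j y)) fun _ => coupledWeight Δ) T
          (BanditAlgorithm.pulls i) := by
      nlinarith
    have := mul_le_mul_of_nonneg_left this hΔ0
    nlinarith
  by_contra! hcon
  have hw : IsAdaptiveProb fun (t : ℕ) (_ : Fin t → Fin 3) => coupledWeight Δ := by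
    refine ⟨fun _ _ y => ?_, fun _ _ => ?_⟩
    · fin_cases y <;> simp [coupledWeight] <;> linarith
    · simp [coupledWeight, Fin.sum_univ_three]
      ring
  have hle := adaptiveExp_mono hw T fun ω =>
    (hcon (fun t j => boolLoss (coupledLoss i j (ω t)))
      ⟨i, fun t j => boolLoss_coupledLoss_le i j (ω t)⟩).le
  rw [adaptiveExp_const hw] at hle
  linarith
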